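/- Let $a<b$, $c<d$ and let $f\colon [a,b]\times[c,d]\to\mathbb{R}$ be such that $f(x,\cdot)\colon[c,d]\to\mathbb{R}$ is absolutely continuous for every $x\in[a,b]$ and $f(\cdot,y)\colon[a,b]\to\mathbb{R}$ is absolutely continuous for every $y\in[c,d]$. Write $|\cdot|$ for Lebesgue measure and $\partial_1,\partial_2$ for the (pointwise) partial derivatives in the first and second variable. The following two properties are equivalent: (i) There is a measurable set $e_1\subset(a,b)$ with $|e_1|=b-a$ such that for every $x\in e_1$ the derivative $\partial_1 f(x,y)$ exists for every $y\in[c,d]$, and there is a constant $K$ such that $\partial_1 f(x,\cdot)$ is $K$-Lipschitz on $[c,d]$ for every $x\in e_1$. (ii) There is a measurable set $e_2\subset(c,d)$ with $|e_2|=d-c$ such that for every $y\in e_2$ the derivative $\partial_2 f(x,y)$ exists for every $x\in[a,b]$, and there is a constant $K$ such that $\partial_2 f(\cdot,y)$ is $K$-Lipschitz on $[a,b]$ for every $y\in e_2$. Moreover, if they hold, then for any sets $e_1$ as in (i) and $e_2$ as in (ii) there is a measurable set $E\subset e_1\times e_2$ with $|E|=(b-a)(d-c)$ such that at every point of $E$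 the function $f$ is differentiable, the mixed partial derivatives $\partial_2\partial_1 f$ and $\partial_1\partial_2 f$ exist, both are bounded on $E$, and $\partial_2\partial_1 f=\partial_1\partial_2 f$ on $E$. -/

import Mathlib

open Set MeasureTheory
open scoped NNReal

/-- The first partial derivative `∂₁ f`. It is only evaluated where the derivative is
also shown or assumed to exist. -/
noncomputable def partialFst (f : ℝ × ℝ → ℝ) (p : ℝ × ℝ) : ℝ :=
  deriv (fun t : ℝ => f (t, p.2)) p.1

/-- The second partial derivative `∂₂ f`. -/
noncomputable def partialSnd (f : ℝ × ℝ → ℝ) (p : ℝ × ℝ) : ℝ :=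
  deriv (fun t : ℝ => f (p.1, t)) p.2

/-- `∂₁ f` exists at `p`. -/
def HasPartialFst (f : ℝ × ℝ → ℝ) (p : ℝ × ℝ) : Prop :=
  DifferentiableAt ℝ (fun t : ℝ => f (t, p.2)) p.1

/-- `∂₂ f` exists at `p`. -/
def HasPartialSnd (f : ℝ × ℝ → ℝ) (p : ℝ × ℝ) : Prop :=
  DifferentiableAt ℝ (fun t : ℝ => f (p.1, t)) p.2

/-- `s` is a Lebesgue measurable subset of `(a, b)` of measure `b - a`. -/
def IsFullSubset (s : Set ℝ) (a b : ℝ) : Prop :=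
  s ⊆ Ioo a b ∧ NullMeasurableSet s volume ∧ volume s = ENNReal.ofReal (b - a)

/-- `e₁ ⊆ (a, b)` has full measure and, for `x ∈ e₁`, the derivative `∂₁ f (x, ·)` exists
on all of `[c, d]` and is Lipschitz there with a constant not depending on `x`.
Points of `e₁` are interior to `[a, b]`, so the values of `f` off the rectangle are irrelevant. -/
def LipschitzPartialFstOn (f : ℝ × ℝ → ℝ) (a b c d : ℝ) (e₁ : Set ℝ) : Prop :=
  IsFullSubset e₁ a b ∧
  (∀ x ∈ e₁, ∀ y ∈ Icc c d, HasPartialFst f (x, y)) ∧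
  ∃ K : ℝ≥0, ∀ x ∈ e₁, LipschitzOnWith K (fun y : ℝ => partialFst f (x, y)) (Icc c d)

/-- `e₂ ⊆ (c, d)` has full measure and, for `y ∈ e₂`, the derivative `∂₂ f (·, y)` exists
on all of `[a, b]` and is Lipschitz there with a constant not depending on `y`. -/
def LipschitzPartialSndOn (f : ℝ × ℝ → ℝ) (a b c d : ℝ) (e₂ : Set ℝ) : Prop :=
  IsFullSubset e₂ c d ∧
  (∀ y ∈ e₂, ∀ x ∈ Icc a b, HasPartialSnd f (x, y)) ∧
  ∃ K : ℝ≥0, ∀ y ∈ e₂, LipschitzOnWith K (fun x : ℝ => partialSnd f (x, y)) (Icc a b)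

open Filter Topology


/-- `F` is separately Lipschitz and its mixed second differences over rectangles are bounded by
`K` times the area. -/
structure BoundedMixedIncrement (K L : ℝ≥0) (F : ℝ × ℝ → ℝ) : Prop where
  fst : ∀ y, LipschitzWith L (fun x => F (x, y))
  snd : ∀ x, LipschitzWith L (fun y => F (x, y))
  mixed : ∀ x x' y y',
    |F (x', y') - F (x, y') - F (x', y) + F (x, y)| ≤ K * |x' - x| * |y' - y|

namespace BoundedMixedIncrement

variable {K L : ℝ≥0} {F : ℝ × ℝ → ℝ}

theorem swap (h : BoundedMixedIncrement K L F) :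
    BoundedMixedIncrement K L (fun p => F p.swap) where
  fst := h.snd
  snd := h.fst
  mixed x x' y y' := by
    have := h.mixed y y' x x'
    simp only [Prod.swap_prod_mk]
    calc _ = |F (y', x') - F (y, x') - F (y', x) + F (y, x)| := by congr 1; ring
      _ ≤ _ := this
      _ = _ := by ring

theorem continuous (h : BoundedMixedIncrement K L F) : Continuous F := by
  have := LipschitzWith.uncurry (f := fun x y => F (x, y)) h.fst h.snd
  exact this.continuous

theorem abs_slope_sub_slope_le (h : BoundedMixedIncrement K L F) (x x' : ℝ) {y t : ℝ}
    (ht : t ≠ y) :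
    |slope (fun t => F (x', t)) y t - slope (fun t => F (x, t)) y t| ≤ K * |x' - x| := by
  have h1 : t - y ≠ 0 := sub_ne_zero.2 ht
  rw [slope_def_field, slope_def_field, ← sub_div, abs_div, div_le_iff₀ (abs_pos.2 h1)]
  refine le_trans (le_of_eq ?_) (h.mixed x x' y t)
  congr 1; ring

theorem differentiableAt_snd_of_dense (h : BoundedMixedIncrement K L F) {D : Set ℝ}
    (hD : Dense D) {y : ℝ} (hy : ∀ x ∈ D, HasPartialSnd F (x, y)) (x : ℝ) :
    HasPartialSnd F (x, y) := by
  have hc : Cauchy (map (slope (fun t => F (x, t)) y) (𝓝[≠] y)) := by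
    refine Metric.cauchy_iff.2 ⟨inferInstance, fun ε hε => ?_⟩
    obtain ⟨x₀, hx₀, hlt⟩ : ∃ x₀ ∈ D, K * |x - x₀| < ε / 4 := by
      have ho : IsOpen {x₀ : ℝ | K * |x - x₀| < ε / 4} :=
        isOpen_lt (by fun_prop) continuous_const
      obtain ⟨z, hz, hzD⟩ := hD.inter_open_nonempty _ ho ⟨x, by simpa using hε⟩
      exact ⟨z, hzD, hz⟩
    have hlim := hasDerivAt_iff_tendsto_slope.1 (hy x₀ hx₀).hasDerivAt
    have hball := hlim (Metric.ball_mem_nhds _ (show 0 < ε / 4 by positivity))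
    refine ⟨_, image_mem_map (inter_mem hball (self_mem_nhdsWithin (s := {y}ᶜ))), ?_⟩
    rintro _ ⟨t, ⟨ht, hty⟩, rfl⟩ _ ⟨s, ⟨hs, hsy⟩, rfl⟩
    have e1 := h.abs_slope_sub_slope_le x₀ x (y := y) (t := t) hty
    have e2 := h.abs_slope_sub_slope_le x₀ x (y := y) (t := s) hsy
    simp only [mem_preimage, Metric.mem_ball, Real.dist_eq, abs_lt, abs_le] at *
    constructor <;> linarith [e1.1, e1.2, e2.1, e2.2, ht.1, ht.2, hs.1, hs.2]
  obtain ⟨l, hl⟩ := cauchy_map_iff_exists_tendsto.1 hc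
  exact (hasDerivAt_iff_tendsto_slope.2 hl).differentiableAt

theorem lipschitzWith_partialSnd (h : BoundedMixedIncrement K L F) {y : ℝ}
    (hy : ∀ x, HasPartialSnd F (x, y)) : LipschitzWith K (fun x => partialSnd F (x, y)) := by
  refine LipschitzWith.of_dist_le_mul fun x x' => ?_
  have h1 := hasDerivAt_iff_tendsto_slope.1 (hy x).hasDerivAt
  have h2 := hasDerivAt_iff_tendsto_slope.1 (hy x').hasDerivAt
  rw [Real.dist_eq, Real.dist_eq]
  refine le_of_tendsto (h1.sub h2).abs ?_
  filter_upwards [self_mem_nhdsWithin] with t ht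
  exact h.abs_slope_sub_slope_le x' x ht

theorem ae_hasPartialSnd (h : BoundedMixedIncrement K L F) :
    ∀ᵐ y, ∀ x, HasPartialSnd F (x, y) := by
  have : ∀ᵐ y, ∀ q : ℚ, HasPartialSnd F (q, y) :=
    ae_all_iff.2 fun q => (h.snd q).ae_differentiableAt_real
  filter_upwards [this] with y hy
  refine h.differentiableAt_snd_of_dense Rat.denseRange_cast ?_
  rintro _ ⟨q, rfl⟩
  exact hy q

theorem measurable_partialSnd (h : BoundedMixedIncrement K L F) : Measurable (partialSnd F) :=
  measurable_deriv_with_param (f := fun x y => F (x, y)) h.continuous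

/-- A jointly measurable version of `∂₂ F` all of whose first sections are Lipschitz. -/
theorem exists_measurable_partialSnd (h : BoundedMixedIncrement K L F) :
    ∃ G : ℝ × ℝ → ℝ, Measurable G ∧ (∀ y, LipschitzWith K (fun x => G (x, y))) ∧
      (∀ p, |G p| ≤ L) ∧
      ∀ᵐ y, ∀ x, G (x, y) = partialSnd F (x, y) := by
  obtain ⟨S, hS, hSm, hS0⟩ := exists_measurable_superset_of_null (ae_iff.1 h.ae_hasPartialSnd)
  obtain ⟨T, hTs, hTm, hTn⟩ : ∃ T : Set ℝ, (∀ y ∈ T, ∀ x, HasPartialSnd F (x, y)) ∧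
      MeasurableSet T ∧ ∀ᵐ y, y ∈ T :=
    ⟨Sᶜ, fun y hy => not_not.1 fun hn => hy (hS hn), hSm.compl, measure_eq_zero_iff_ae_notMem.1 hS0⟩
  classical
  refine ⟨fun p => if p.2 ∈ T then partialSnd F p else 0,
    Measurable.ite (hTm.preimage measurable_snd) h.measurable_partialSnd measurable_const,
    fun y => ?_, fun p => ?_, ?_⟩
  · by_cases hy : y ∈ T
    · simpa [hy] using h.lipschitzWith_partialSnd (hTs y hy)
    · simpa [hy] using LipschitzWith.const' (0 : ℝ)
  · by_cases hy : p.2 ∈ T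
    · simpa [hy, partialSnd] using norm_deriv_le_of_lipschitz (x₀ := p.2) (h.snd p.1)
    · simp [hy]
  · filter_upwards [hTn] with y hy x
    simp [hy]

end BoundedMixedIncrement

theorem hasDerivAt_iff_forall_rat {g : ℝ → ℝ} (hg : Continuous g) {v y : ℝ} :
    HasDerivAt g v y ↔ ∀ n : ℕ, ∃ m : ℕ, ∀ r : ℚ, |(r : ℝ)| < 1 / (m + 1 : ℝ) →
      |g (y + r) - g y - r * v| ≤ 1 / (n + 1 : ℝ) * |(r : ℝ)| := by
  rw [hasDerivAt_iff_isLittleO_nhds_zero, Asymptotics.isLittleO_iff]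
  constructor
  · intro h n
    obtain ⟨δ, hδ, hb⟩ := Metric.eventually_nhds_iff.1
      (h (show (0 : ℝ) < 1 / (n + 1 : ℝ) by positivity))
    obtain ⟨m, hm⟩ := exists_nat_one_div_lt hδ
    refine ⟨m, fun r hr => ?_⟩
    have := hb (y := (r : ℝ)) (by rw [dist_zero_right]; exact hr.trans hm)
    simpa only [Real.norm_eq_abs, smul_eq_mul] using this
  · intro h ε hε
    obtain ⟨n, hn⟩ := exists_nat_one_div_lt hε
    obtain ⟨m, hm⟩ := h n
    filter_upwards [Metric.ball_mem_nhds (0 : ℝ) (show (0 : ℝ) < 1 / (m + 1 : ℝ) by positivity)]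
      with r hr
    have hcl : r ∈ closure (Metric.ball (0 : ℝ) (1 / (m + 1 : ℝ)) ∩ range ((↑) : ℚ → ℝ)) :=
      (Rat.denseRange_cast (𝕜 := ℝ)).open_subset_closure_inter Metric.isOpen_ball hr
    have hclosed : IsClosed {r : ℝ | |g (y + r) - g y - r * v| ≤ 1 / (n + 1 : ℝ) * |r|} :=
      isClosed_le (by fun_prop) (by fun_prop)
    have hmem := closure_minimal (t := {r : ℝ | |g (y + r) - g y - r * v| ≤ 1 / (n + 1 : ℝ) * |r|})
      (by rintro _ ⟨h1, q, rfl⟩; exact hm q (by rwa [mem_ball_zero_iff] at h1)) hclosed hcl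
    simp only [Real.norm_eq_abs, smul_eq_mul]
    exact le_trans hmem (by gcongr)

theorem measurableSet_hasDerivAt_snd {G v : ℝ × ℝ → ℝ} (hG : Measurable G) (hv : Measurable v)
    (hc : ∀ x, Continuous (fun y => G (x, y))) :
    MeasurableSet {p : ℝ × ℝ | HasDerivAt (fun t => G (p.1, t)) (v p) p.2} := by
  simp only [hasDerivAt_iff_forall_rat (hc _), ofPred_forall, ofPred_exists]
  refine .iInter fun n => .iUnion fun m => .iInter fun r => .iInter fun _ =>
    measurableSet_le ?_ measurable_const
  fun_prop

theorem measurableSet_hasDerivAt_fst {G v : ℝ × ℝ → ℝ} (hG : Measurable G) (hv : Measurable v)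
    (hc : ∀ y, Continuous (fun x => G (x, y))) :
    MeasurableSet {p : ℝ × ℝ | HasDerivAt (fun t => G (t, p.2)) (v p) p.1} :=
  (measurableSet_hasDerivAt_snd (G := fun p => G p.swap) (v := fun p => v p.swap)
    (hG.comp measurable_swap) (hv.comp measurable_swap) hc).preimage measurable_swap

/-- A jointly measurable bounded version of the derivative in the first variable. -/
theorem exists_measurable_deriv_fst {K : ℝ≥0} {G : ℝ × ℝ → ℝ} (hG : Measurable G)
    (hl : ∀ y, LipschitzWith K (fun x => G (x, y))) :
    ∃ v : ℝ × ℝ → ℝ, Measurable v ∧ (∀ p, |v p| ≤ K) ∧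
      ∀ y, ∀ᵐ x, HasDerivAt (fun t => G (t, y)) (v (x, y)) x := by
  refine ⟨fun p => max (-K) (min K (limsup (fun n : ℕ =>
    (n + 1 : ℝ) * (G (p.1 + 1 / (n + 1 : ℝ), p.2) - G p)) atTop)), ?_, fun p => ?_, fun y => ?_⟩
  · refine measurable_const.max (measurable_const.min (Measurable.limsup fun n => ?_))
    fun_prop
  · exact abs_le.2 ⟨le_max_left _ _, max_le (by linarith [K.coe_nonneg]) (min_le_left _ _)⟩
  · filter_upwards [(hl y).ae_differentiableAt_real] with x hx
    have hb := abs_le.1 (norm_deriv_le_of_lipschitz (x₀ := x) (hl y))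
    have ht : Tendsto (fun n : ℕ => (n + 1 : ℝ) * (G (x + 1 / (n + 1 : ℝ), y) - G (x, y))) atTop
        (𝓝 (deriv (fun t => G (t, y)) x)) := by
      have h0 : Tendsto (fun n : ℕ => x + 1 / (n + 1 : ℝ)) atTop (𝓝[≠] x) := by
        refine tendsto_nhdsWithin_iff.2 ⟨?_, Eventually.of_forall fun n => ?_⟩
        · simpa using tendsto_const_nhds.add (tendsto_one_div_add_atTop_nhds_zero_nat (𝕜 := ℝ))
        · have : (0 : ℝ) < 1 / (n + 1 : ℝ) := by positivity
          simp only [mem_compl_iff, mem_singleton_iff]; linarith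
      refine ((hasDerivAt_iff_tendsto_slope.1 hx.hasDerivAt).comp h0).congr fun n => ?_
      simp [slope_def_field, div_eq_mul_inv, mul_comm]
    rw [ht.limsup_eq, min_eq_right hb.2, max_eq_right hb.1]
    exact hx.hasDerivAt

theorem integrableOn_of_abs_le {α : Type*} [MeasurableSpace α] {μ : Measure α} {K : ℝ}
    {v : α → ℝ} (hv : Measurable v)
    (hK : ∀ p, |v p| ≤ K) {s : Set α} (hs : μ s < ⊤) : IntegrableOn v s μ :=
  Measure.integrableOn_of_bounded hs.ne hv.aestronglyMeasurable (Eventually.of_forall hK)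

theorem LipschitzWith.integral_deriv_eq_sub {C : ℝ≥0} {g : ℝ → ℝ} (hg : LipschitzWith C g)
    (a b : ℝ) : ∫ x in a..b, deriv g x = g b - g a :=
  (hg.lipschitzOnWith (s := uIcc a b)).absolutelyContinuousOnInterval.integral_deriv_eq_sub

theorem locallyIntegrable_of_abs_le {K : ℝ} {v : ℝ → ℝ} (hv : Measurable v)
    (hK : ∀ p, |v p| ≤ K) : LocallyIntegrable v :=
  (locallyIntegrable_const K).mono hv.aestronglyMeasurable
    (Eventually.of_forall fun p => (hK p).trans (le_abs_self K))

namespace BoundedMixedIncrement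

variable {K L : ℝ≥0} {F : ℝ × ℝ → ℝ}

theorem exists_integral_eq (h : BoundedMixedIncrement K L F) :
    ∃ v : ℝ × ℝ → ℝ, Measurable v ∧ (∀ p, |v p| ≤ K) ∧
      (∀ᵐ p, HasDerivAt (fun t => partialSnd F (t, p.2)) (v p) p.1) ∧
      ∀ x y, F (x, y) - F (x, 0) - F (0, y) + F (0, 0) = ∫ s in 0..x, ∫ t in 0..y, v (s, t) := by
  obtain ⟨G, hGm, hGl, hGb, hGe⟩ := h.exists_measurable_partialSnd
  obtain ⟨v, hvm, hvb, hvd⟩ := exists_measurable_deriv_fst hGm hGl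
  refine ⟨v, hvm, hvb, ?_, fun x y => ?_⟩
  · have h1 : ∀ᵐ p : ℝ × ℝ, HasDerivAt (fun t => G (t, p.2)) (v p) p.1 := by
      rw [Measure.volume_eq_prod, ← Measure.prod_swap, ae_map_iff (by fun_prop)
        (measurableSet_hasDerivAt_fst hGm hvm fun y => (hGl y).continuous)]
      exact (Measure.ae_prod_iff_ae_ae
        ((measurableSet_hasDerivAt_fst hGm hvm fun y => (hGl y).continuous).preimage
          measurable_swap)).2 (Eventually.of_forall hvd)
    have h2 : ∀ᵐ p : ℝ × ℝ, ∀ x, G (x, p.2) = partialSnd F (x, p.2) :=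
      Measure.quasiMeasurePreserving_snd.ae hGe
    filter_upwards [h1, h2] with p hp hp'
    simpa only [hp'] using hp
  · have e1 : ∀ x, F (x, y) - F (x, 0) = ∫ t in 0..y, G (x, t) := fun x => by
      rw [← (h.snd x).integral_deriv_eq_sub 0 y]
      refine intervalIntegral.integral_congr_ae ?_
      filter_upwards [hGe] with t ht _
      exact (ht x).symm
    have hint : ∀ x, IntervalIntegrable (fun t => G (x, t)) volume 0 y := fun x =>
      intervalIntegrable_iff.2 (integrableOn_of_abs_le (by fun_prop) (fun t => hGb _)
        (by simp))
    have e2 : ∀ t, ∫ s in 0..x, v (s, t) = G (x, t) - G (0, t) := fun t => by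
      rw [← (hGl t).integral_deriv_eq_sub 0 x]
      refine intervalIntegral.integral_congr_ae ?_
      filter_upwards [hvd t] with s hs _
      exact hs.deriv.symm
    rw [intervalIntegral_intervalIntegral_swap (F := fun s t => v (s, t))
      (integrableOn_of_abs_le hvm hvb ?_)]
    · simp only [e2]
      rw [intervalIntegral.integral_sub (hint x) (hint 0), ← e1, ← e1]
      ring
    · rw [Measure.volume_eq_prod, Measure.prod_prod]
      exact ENNReal.mul_lt_top (by simp) (by simp)

theorem ae_mixed_partials (h : BoundedMixedIncrement K L F) :
    ∀ᵐ p : ℝ × ℝ, ∃ v : ℝ, |v| ≤ K ∧ HasDerivAt (fun t => partialFst F (p.1, t)) v p.2 ∧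
      HasDerivAt (fun t => partialSnd F (t, p.2)) v p.1 := by
  obtain ⟨v, hvm, hvb, hvd, hvi⟩ := h.exists_integral_eq
  obtain ⟨G, hGm, hGl, -, hGe⟩ := h.swap.exists_measurable_partialSnd
  have hli : ∀ x, LocallyIntegrable (fun t => v (x, t)) volume := fun x =>
    locallyIntegrable_of_abs_le (by fun_prop) fun t => hvb _
  have hii : ∀ x c d, IntervalIntegrable (fun t => v (x, t)) volume c d := fun x c d =>
    intervalIntegrable_iff.2 (integrableOn_of_abs_le (by fun_prop) (fun t => hvb _) (by simp))
  have key : ∀ᵐ x, ∀ y, partialFst F (x, y) = partialFst F (x, 0) + ∫ t in 0..y, v (x, t) := by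
    have hq : ∀ᵐ x, ∀ q : ℚ,
        HasDerivAt (fun x => ∫ s in 0..x, ∫ t in 0..(q : ℝ), v (s, t))
          (∫ t in 0..(q : ℝ), v (x, t)) x := by
      refine ae_all_iff.2 fun q => ?_
      have hm : Measurable fun s => ∫ t in 0..(q : ℝ), v (s, t) := by
        simp only [intervalIntegral.intervalIntegral_eq_integral_uIoc]
        exact (measurable_const (a := if (0 : ℝ) ≤ q then (1 : ℝ) else -1)).smul
          (hvm.stronglyMeasurable.integral_prod_right'
          (ν := volume.restrict (uIoc 0 (q : ℝ)))).measurable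
      have hb : ∀ s, |∫ t in 0..(q : ℝ), v (s, t)| ≤ K * |(q : ℝ) - 0| := fun s =>
        by
        simpa only [Real.norm_eq_abs] using intervalIntegral.norm_integral_le_of_norm_le_const
          (f := fun t => v (s, t)) (C := K) (a := 0) (b := q) fun t _ => hvb _
      filter_upwards [LocallyIntegrable.ae_hasDerivAt_integral (locallyIntegrable_of_abs_le hm hb)]
        with x hx
      exact hx 0
    filter_upwards [hq, h.swap.ae_hasPartialSnd] with x hx hd
    have hcl : LipschitzWith K fun y => partialFst F (x, y) := h.swap.lipschitzWith_partialSnd hd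
    refine fun y => congrFun (Continuous.ext_on Rat.denseRange_cast hcl.continuous
      (continuous_const.add (intervalIntegral.continuous_primitive (hii x) 0)) ?_) y
    rintro _ ⟨q, rfl⟩
    have hd' : ∀ y, HasDerivAt (fun s => F (s, y)) (partialFst F (x, y)) x := fun y =>
      (hd y).hasDerivAt
    have e := (((hd' q).sub (hd' 0)).sub_const (F (0, (q : ℝ)) - F (0, 0))).unique
      ((hx q).congr_of_eventuallyEq (Eventually.of_forall fun s => ?_))
    · change _ = partialFst F (x, 0) + ∫ t in 0..(q : ℝ), v (x, t)
      linarith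
    · simp only [← hvi, Pi.sub_apply]; ring
  have hm := measurableSet_hasDerivAt_snd (G := fun p => G p.swap) (hGm.comp measurable_swap)
    hvm fun x => (hGl x).continuous
  have h1 : ∀ᵐ p : ℝ × ℝ, HasDerivAt (fun t => G (t, p.1)) (v p) p.2 := by
    refine (Measure.ae_prod_iff_ae_ae hm).2 ?_
    filter_upwards [key, hGe] with x hx hGx
    filter_upwards [LocallyIntegrable.ae_hasDerivAt_integral (hli x)] with y hy
    refine ((hy 0).const_add (partialFst F (x, 0))).congr_of_eventuallyEq
      (Eventually.of_forall fun t => ?_)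
    exact (hGx t).trans (hx t)
  have h2 : ∀ᵐ p : ℝ × ℝ, ∀ y, G (y, p.1) = partialFst F (p.1, y) :=
    Measure.quasiMeasurePreserving_fst.ae hGe
  filter_upwards [h1, h2, hvd] with p hp hp' hpv
  refine ⟨v p, hvb p, ?_, hpv⟩
  simpa only [hp'] using hp

end BoundedMixedIncrement

/-- The mixed second differences of `f` over rectangles in `[a, b] × [c, d]` are bounded by `K`
times the area. -/
def BoundedMixedIncrementOn (K : ℝ≥0) (f : ℝ × ℝ → ℝ) (a b c d : ℝ) : Prop :=
  ∀ x ∈ Icc a b, ∀ x' ∈ Icc a b, ∀ y ∈ Icc c d, ∀ y' ∈ Icc c d,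
    |f (x', y') - f (x, y') - f (x', y) + f (x, y)| ≤ K * |x' - x| * |y' - y|

theorem IsFullSubset.ae_mem {s : Set ℝ} {a b : ℝ} (hs : IsFullSubset s a b) :
    ∀ᵐ x, x ∈ Ioo a b → x ∈ s := by
  have h : s =ᵐ[volume] Ioo a b := ae_eq_of_subset_of_measure_ge hs.1
    (by rw [hs.2.2, Real.volume_Ioo]) hs.2.1 (by simp)
  exact h.symm.le

theorem IsFullSubset.prod {s t : Set ℝ} {a b c d : ℝ} (hs : IsFullSubset s a b)
    (ht : IsFullSubset t c d) (hab : a ≤ b) :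
    NullMeasurableSet (s ×ˢ t) volume ∧
      volume (s ×ˢ t) = ENNReal.ofReal ((b - a) * (d - c)) :=
  ⟨hs.2.1.prod ht.2.1, by
    rw [Measure.volume_eq_prod, Measure.prod_prod, hs.2.2, ht.2.2,
      ENNReal.ofReal_mul (sub_nonneg.2 hab)]⟩

theorem isFullSubset_of_ae {p : ℝ → Prop} {a b : ℝ} (hp : ∀ᵐ x, x ∈ Ioo a b → p x) :
    IsFullSubset {x | x ∈ Ioo a b ∧ p x} a b := by
  have h : {x | x ∈ Ioo a b ∧ p x} =ᵐ[volume] Ioo a b := by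
    filter_upwards [hp] with x hx
    exact propext ⟨fun h => h.1, fun h => ⟨h, hx h⟩⟩
  exact ⟨fun x hx => hx.1, measurableSet_Ioo.nullMeasurableSet.congr h.symm,
    by rw [measure_congr h, Real.volume_Ioo]⟩

/-- Mean value inequality for absolutely continuous functions. -/
theorem AbsolutelyContinuousOnInterval.abs_sub_le_of_ae_deriv_le {g : ℝ → ℝ} {u v C : ℝ}
    (hg : AbsolutelyContinuousOnInterval g u v) (hC : ∀ᵐ x, x ∈ uIoc u v → |deriv g x| ≤ C) :
    |g v - g u| ≤ C * |v - u| := by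
  rw [← hg.integral_deriv_eq_sub]
  exact intervalIntegral.norm_integral_le_of_norm_le_const_ae (f := deriv g) hC

theorem LipschitzPartialFstOn.boundedMixedIncrementOn {a b c d : ℝ} {f : ℝ × ℝ → ℝ}
    (hf₁ : ∀ y ∈ Icc c d, AbsolutelyContinuousOnInterval (fun x : ℝ => f (x, y)) a b)
    {e₁ : Set ℝ} (h : LipschitzPartialFstOn f a b c d e₁) :
    ∃ K, BoundedMixedIncrementOn K f a b c d := by
  obtain ⟨he, hd, K, hK⟩ := h
  refine ⟨K, fun x hx x' hx' y hy y' hy' => ?_⟩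
  have hac := ((hf₁ y' hy').sub (hf₁ y hy)).mono (c := x) (d := x')
    ((uIcc_subset_Icc hx hx').trans Icc_subset_uIcc)
  have hb : ∀ᵐ s, s ∈ uIoc x x' →
      |deriv ((fun x => f (x, y')) - fun x => f (x, y)) s| ≤ K * |y' - y| := by
    filter_upwards [he.ae_mem, Measure.ae_ne volume a, Measure.ae_ne volume b]
      with s hs ha hb hmem
    have hs' := uIcc_subset_Icc hx hx' (uIoc_subset_uIcc hmem)
    have hse := hs ⟨lt_of_le_of_ne hs'.1 ha.symm, lt_of_le_of_ne hs'.2 hb⟩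
    rw [((hd s hse y' hy').hasDerivAt.sub (hd s hse y hy).hasDerivAt).deriv]
    exact (hK s hse).dist_le_mul y' hy' y hy
  have := hac.abs_sub_le_of_ae_deriv_le hb
  simp only [Pi.sub_apply] at this
  calc _ = |f (x', y') - f (x', y) - (f (x, y') - f (x, y))| := by congr 1; ring
    _ ≤ _ := this
    _ = _ := by ring

/-- The mixed increment of `f` from the corner `(a, c)`, extended from `[a, b] × [c, d]` to the
plane by projecting. -/
noncomputable def cornerIncrement (f : ℝ × ℝ → ℝ) {a b c d : ℝ} (hab : a ≤ b) (hcd : c ≤ d)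
    (p : ℝ × ℝ) : ℝ :=
  f (projIcc a b hab p.1, projIcc c d hcd p.2) - f (a, projIcc c d hcd p.2) -
    f (projIcc a b hab p.1, c) + f (a, c)

theorem cornerIncrement_eq (f : ℝ × ℝ → ℝ) {a b c d : ℝ} (hab : a ≤ b) (hcd : c ≤ d) {x y : ℝ}
    (hx : x ∈ Icc a b) (hy : y ∈ Icc c d) :
    cornerIncrement f hab hcd (x, y) = f (x, y) - f (a, y) - f (x, c) + f (a, c) := by
  simp [cornerIncrement, projIcc_of_mem hab hx, projIcc_of_mem hcd hy]

theorem BoundedMixedIncrementOn.cornerIncrement {K : ℝ≥0} {f : ℝ × ℝ → ℝ} {a b c d : ℝ}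
    (h : BoundedMixedIncrementOn K f a b c d) (hab : a ≤ b) (hcd : c ≤ d) :
    ∃ L, BoundedMixedIncrement K L (cornerIncrement f hab hcd) := by
  have hP : ∀ x, (projIcc a b hab x : ℝ) ∈ Icc a b := fun x => (projIcc a b hab x).2
  have hQ : ∀ y, (projIcc c d hcd y : ℝ) ∈ Icc c d := fun y => (projIcc c d hcd y).2
  have ha := left_mem_Icc.2 hab
  have hc := left_mem_Icc.2 hcd
  refine ⟨K * (b - a).toNNReal + K * (d - c).toNNReal, fun y => ?_, fun x => ?_,
    fun x x' y y' => ?_⟩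
  · refine LipschitzWith.of_dist_le_mul fun x' x => ?_
    have h1 := h _ (hP x) _ (hP x') c hc _ (hQ y)
    rw [Real.dist_eq, Real.dist_eq]
    push_cast
    rw [Real.coe_toNNReal _ (sub_nonneg.2 hab), Real.coe_toNNReal _ (sub_nonneg.2 hcd)]
    calc _ = |_| := by congr 1; simp only [_root_.cornerIncrement]; ring
      _ ≤ _ := h1
      _ ≤ K * |x' - x| * (d - c) := by
        refine mul_le_mul (mul_le_mul_of_nonneg_left (abs_projIcc_sub_projIcc hab) K.coe_nonneg)
          ?_ (abs_nonneg _) (by positivity)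
        rw [abs_of_nonneg (sub_nonneg.2 (hQ y).1)]; linarith [(hQ y).2]
      _ ≤ _ := by
        nlinarith [mul_nonneg (mul_nonneg K.coe_nonneg (abs_nonneg (x' - x))) (sub_nonneg.2 hab)]
  · refine LipschitzWith.of_dist_le_mul fun y' y => ?_
    have h1 := h a ha _ (hP x) _ (hQ y) _ (hQ y')
    rw [Real.dist_eq, Real.dist_eq]
    push_cast
    rw [Real.coe_toNNReal _ (sub_nonneg.2 hab), Real.coe_toNNReal _ (sub_nonneg.2 hcd)]
    calc _ = |_| := by congr 1; simp only [_root_.cornerIncrement]; ring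
      _ ≤ _ := h1
      _ ≤ K * (b - a) * |y' - y| := by
        refine mul_le_mul (mul_le_mul_of_nonneg_left ?_ K.coe_nonneg)
          (abs_projIcc_sub_projIcc hcd) (abs_nonneg _)
          (mul_nonneg K.coe_nonneg (sub_nonneg.2 hab))
        rw [abs_of_nonneg (sub_nonneg.2 (hP x).1)]; linarith [(hP x).2]
      _ ≤ _ := by
        nlinarith [mul_nonneg (mul_nonneg K.coe_nonneg (abs_nonneg (y' - y))) (sub_nonneg.2 hcd)]
  · have h1 := h _ (hP x) _ (hP x') _ (hQ y) _ (hQ y')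
    calc _ = |_| := by congr 1; simp only [_root_.cornerIncrement]; ring
      _ ≤ _ := h1
      _ ≤ _ := mul_le_mul
        (mul_le_mul_of_nonneg_left (abs_projIcc_sub_projIcc hab) K.coe_nonneg)
        (abs_projIcc_sub_projIcc hcd) (abs_nonneg _) (by positivity)

/-- Near an interior ordinate, `f (x, ·)` is the corner increment plus `f (a, ·)` plus a
constant. -/
theorem eventuallyEq_cornerIncrement_snd (f : ℝ × ℝ → ℝ) {a b c d : ℝ} (hab : a ≤ b)
    (hcd : c ≤ d) {x y : ℝ} (hx : x ∈ Icc a b) (hy : y ∈ Ioo c d) :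
    (fun t => f (x, t)) =ᶠ[𝓝 y]
      fun t => cornerIncrement f hab hcd (x, t) + f (a, t) + (f (x, c) - f (a, c)) := by
  filter_upwards [Ioo_mem_nhds hy.1 hy.2] with t ht
  rw [cornerIncrement_eq f hab hcd hx (Ioo_subset_Icc_self ht)]
  ring

theorem cornerIncrement_swap (f : ℝ × ℝ → ℝ) {a b c d : ℝ} (hab : a ≤ b) (hcd : c ≤ d) :
    cornerIncrement (fun p => f p.swap) hcd hab = fun p => cornerIncrement f hab hcd p.swap := by
  ext p
  simp only [cornerIncrement, Prod.fst_swap, Prod.snd_swap, Prod.swap_prod_mk]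
  ring

theorem BoundedMixedIncrementOn.exists_lipschitzPartialSndOn {K : ℝ≥0} {f : ℝ × ℝ → ℝ}
    {a b c d : ℝ} (h : BoundedMixedIncrementOn K f a b c d) (hab : a ≤ b) (hcd : c ≤ d)
    (hf₂ : ∀ x ∈ Icc a b, AbsolutelyContinuousOnInterval (fun y : ℝ => f (x, y)) c d) :
    ∃ e₂, LipschitzPartialSndOn f a b c d e₂ := by
  obtain ⟨L, hF⟩ := h.cornerIncrement hab hcd
  have ha := left_mem_Icc.2 hab
  have hae : ∀ᵐ y, y ∈ Ioo c d → HasPartialSnd f (a, y) ∧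
      ∀ x, HasPartialSnd (_root_.cornerIncrement f hab hcd) (x, y) := by
    filter_upwards [hF.ae_hasPartialSnd, (hf₂ a ha).ae_differentiableAt] with y h1 h2 hy
    exact ⟨h2 (Icc_subset_uIcc (Ioo_subset_Icc_self hy)), h1⟩
  have hder : ∀ y ∈ {y | y ∈ Ioo c d ∧ HasPartialSnd f (a, y) ∧
      ∀ x, HasPartialSnd (_root_.cornerIncrement f hab hcd) (x, y)}, ∀ x ∈ Icc a b,
      HasDerivAt (fun t => f (x, t))
        (partialSnd (_root_.cornerIncrement f hab hcd) (x, y) + partialSnd f (a, y)) y := by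
    rintro y ⟨hy, h1, h2⟩ x hx
    exact (((h2 x).hasDerivAt.add h1.hasDerivAt).add_const _).congr_of_eventuallyEq
      (eventuallyEq_cornerIncrement_snd f hab hcd hx hy)
  refine ⟨_, isFullSubset_of_ae hae, fun y hy x hx => (hder y hy x hx).differentiableAt, K,
    fun y hy => LipschitzOnWith.of_dist_le_mul fun x hx x' hx' => ?_⟩
  have e : ∀ x ∈ Icc a b, partialSnd f (x, y) =
    partialSnd (_root_.cornerIncrement f hab hcd) (x, y) + partialSnd f (a, y) :=
    fun x hx => (hder y hy x hx).deriv
  simp only [e x hx, e x' hx', dist_add_right]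
  exact (hF.lipschitzWith_partialSnd hy.2.2).dist_le_mul x x'

theorem BoundedMixedIncrementOn.differentiableAt {K : ℝ≥0} {f : ℝ × ℝ → ℝ} {a b c d : ℝ}
    (h : BoundedMixedIncrementOn K f a b c d) {p : ℝ × ℝ} (hp₁ : p.1 ∈ Ioo a b)
    (hp₂ : p.2 ∈ Ioo c d) (h₁ : HasPartialFst f p) (h₂ : HasPartialSnd f p) :
    DifferentiableAt ℝ f p := by
  have d1 : HasFDerivAt (fun q : ℝ × ℝ => f (q.1, p.2))
      ((deriv (fun t => f (t, p.2)) p.1) • ContinuousLinearMap.fst ℝ ℝ ℝ) p :=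
    h₁.hasDerivAt.comp_hasFDerivAt p hasFDerivAt_fst
  have d2 : HasFDerivAt (fun q : ℝ × ℝ => f (p.1, q.2))
      ((deriv (fun t => f (p.1, t)) p.2) • ContinuousLinearMap.snd ℝ ℝ ℝ) p :=
    h₂.hasDerivAt.comp_hasFDerivAt p hasFDerivAt_snd
  have d3 : HasFDerivAt (fun q : ℝ × ℝ => f q - f (q.1, p.2) - f (p.1, q.2))
      (0 : ℝ × ℝ →L[ℝ] ℝ) p := by
    rw [hasFDerivAt_iff_isLittleO_nhds_zero]
    have hO : (fun q : ℝ × ℝ => f (p + q) - f ((p + q).1, p.2) - f (p.1, (p + q).2) -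
        (f p - f (p.1, p.2) - f (p.1, p.2)) - (0 : ℝ × ℝ →L[ℝ] ℝ) q)
        =O[𝓝 0] fun q => ‖q‖ ^ 2 := by
      refine Asymptotics.IsBigO.of_bound K ?_
      have hU : ∀ᶠ q : ℝ × ℝ in 𝓝 0, p + q ∈ Ioo a b ×ˢ Ioo c d := by
        refine (continuous_const.add continuous_id).continuousAt.eventually_mem
          ((isOpen_Ioo.prod isOpen_Ioo).mem_nhds ?_)
        simpa using ⟨hp₁, hp₂⟩
      filter_upwards [hU] with q hq
      have := h p.1 (Ioo_subset_Icc_self hp₁) (p + q).1 (Ioo_subset_Icc_self hq.1)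
        p.2 (Ioo_subset_Icc_self hp₂) (p + q).2 (Ioo_subset_Icc_self hq.2)
      calc _ = |f ((p + q).1, (p + q).2) - f (p.1, (p + q).2) - f ((p + q).1, p.2)
            + f (p.1, p.2)| := by
            rw [Real.norm_eq_abs]; congr 1; simp only [Prod.mk.eta, zero_apply]; ring
        _ ≤ K * |q.1| * |q.2| := by simpa using this
        _ ≤ K * ‖q‖ * ‖q‖ := by
          gcongr
          · exact norm_fst_le q
          · exact norm_snd_le q
        _ = _ := by rw [norm_pow, norm_norm]; ring
    exact hO.trans_isLittleO (Asymptotics.isLittleO_norm_pow_id one_lt_two)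
  refine ((d3.add d1).add d2).differentiableAt.congr_of_eventuallyEq (Eventually.of_forall ?_)
  intro q
  simp only [Pi.add_apply]
  ring

theorem hasDerivAt_partialSnd_of_cornerIncrement {f : ℝ × ℝ → ℝ} {a b c d : ℝ} (hab : a ≤ b)
    (hcd : c ≤ d) {x y v : ℝ} (hx : x ∈ Ioo a b) (hy : y ∈ Ioo c d)
    (h : ∀ x ∈ Icc a b, HasPartialSnd f (x, y))
    (hv : HasDerivAt (fun t => partialSnd (cornerIncrement f hab hcd) (t, y)) v x) :
    HasDerivAt (fun t => partialSnd f (t, y)) v x := by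
  refine (hv.add_const (partialSnd f (a, y))).congr_of_eventuallyEq ?_
  filter_upwards [Ioo_mem_nhds hx.1 hx.2] with s hs
  have hs' := Ioo_subset_Icc_self hs
  have e : (fun t => cornerIncrement f hab hcd (s, t)) =ᶠ[𝓝 y]
      fun t => f (s, t) - f (a, t) - (f (s, c) - f (a, c)) := by
    filter_upwards [eventuallyEq_cornerIncrement_snd f hab hcd hs' hy] with t ht
    rw [ht]; ring
  have hd := (((h s hs').hasDerivAt.sub
    (h a (left_mem_Icc.2 hab)).hasDerivAt).sub_const (f (s, c) - f (a, c))).congr_of_eventuallyEq e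
  have : partialSnd (cornerIncrement f hab hcd) (s, y) =
    partialSnd f (s, y) - partialSnd f (a, y) := hd.deriv
  rw [this]; ring

theorem lipschitzPartialSndOn_swap {f : ℝ × ℝ → ℝ} {a b c d : ℝ} {e : Set ℝ} :
    LipschitzPartialSndOn (fun p => f p.swap) c d a b e ↔ LipschitzPartialFstOn f a b c d e :=
  Iff.rfl

theorem lipschitzPartialFstOn_swap {f : ℝ × ℝ → ℝ} {a b c d : ℝ} {e : Set ℝ} :
    LipschitzPartialFstOn (fun p => f p.swap) c d a b e ↔ LipschitzPartialSndOn f a b c d e :=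
  Iff.rfl

theorem mainTheorem3 (a b c d : ℝ) (hab : a < b) (hcd : c < d) (f : ℝ × ℝ → ℝ)
    (hf₂ : ∀ x ∈ Icc a b, AbsolutelyContinuousOnInterval (fun y : ℝ => f (x, y)) c d)
    (hf₁ : ∀ y ∈ Icc c d, AbsolutelyContinuousOnInterval (fun x : ℝ => f (x, y)) a b) :
    ((∃ e₁ : Set ℝ, LipschitzPartialFstOn f a b c d e₁) ↔
      (∃ e₂ : Set ℝ, LipschitzPartialSndOn f a b c d e₂)) ∧
    (∀ e₁ e₂ : Set ℝ, LipschitzPartialFstOn f a b c d e₁ → LipschitzPartialSndOn f a b c d e₂ →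
      ∃ E : Set (ℝ × ℝ), E ⊆ e₁ ×ˢ e₂ ∧ NullMeasurableSet E volume ∧
        volume E = ENNReal.ofReal ((b - a) * (d - c)) ∧
        (∀ p ∈ E, DifferentiableAt ℝ f p) ∧
        (∀ p ∈ E, HasPartialSnd (partialFst f) p ∧ HasPartialFst (partialSnd f) p) ∧
        (∃ M : ℝ, ∀ p ∈ E, |partialSnd (partialFst f) p| ≤ M ∧
          |partialFst (partialSnd f) p| ≤ M) ∧
        (∀ p ∈ E, partialSnd (partialFst f) p = partialFst (partialSnd f) p)) := by
  refine ⟨⟨?_, ?_⟩, ?_⟩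
  · rintro ⟨e₁, h⟩
    obtain ⟨K, hK⟩ := h.boundedMixedIncrementOn hf₁
    exact hK.exists_lipschitzPartialSndOn hab.le hcd.le hf₂
  · rintro ⟨e₂, h⟩
    obtain ⟨K, hK⟩ := LipschitzPartialFstOn.boundedMixedIncrementOn
      (f := fun p => f p.swap) hf₂ (lipschitzPartialFstOn_swap.2 h)
    obtain ⟨e₁, h₁⟩ := hK.exists_lipschitzPartialSndOn hcd.le hab.le hf₁
    exact ⟨e₁, lipschitzPartialSndOn_swap.1 h₁⟩
  · intro e₁ e₂ h₁ h₂
    obtain ⟨K, hK⟩ := h₁.boundedMixedIncrementOn hf₁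
    obtain ⟨L, hF⟩ := hK.cornerIncrement hab.le hcd.le
    have hae := hF.ae_mixed_partials
    have hprod := h₁.1.prod h₂.1 hab.le
    let E : Set (ℝ × ℝ) := {p | p ∈ e₁ ×ˢ e₂ ∧ ∃ v : ℝ, |v| ≤ K ∧
      HasDerivAt (fun t => partialFst (cornerIncrement f hab.le hcd.le) (p.1, t)) v p.2 ∧
      HasDerivAt (fun t => partialSnd (cornerIncrement f hab.le hcd.le) (t, p.2)) v p.1}
    have hE : E =ᵐ[volume] e₁ ×ˢ e₂ := by
      filter_upwards [hae] with p hp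
      exact propext ⟨fun h => h.1, fun h => ⟨h, hp⟩⟩
    have key : ∀ p ∈ E, ∃ v : ℝ, |v| ≤ K ∧
        HasDerivAt (fun t => partialFst f (p.1, t)) v p.2 ∧
        HasDerivAt (fun t => partialSnd f (t, p.2)) v p.1 := by
      rintro ⟨x, y⟩ ⟨⟨hx, hy⟩, v, hv, hv₁, hv₂⟩
      refine ⟨v, hv, ?_, hasDerivAt_partialSnd_of_cornerIncrement hab.le hcd.le (h₁.1.1 hx)
        (h₂.1.1 hy) (h₂.2.1 y hy) hv₂⟩
      refine hasDerivAt_partialSnd_of_cornerIncrement (f := fun p => f p.swap) hcd.le hab.le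
        (h₂.1.1 hy) (h₁.1.1 hx) (h₁.2.1 x hx) ?_
      rw [cornerIncrement_swap]
      exact hv₁
    refine ⟨E, fun p hp => hp.1, hprod.1.congr hE.symm, (measure_congr hE).trans hprod.2,
      fun p hp => ?_, fun p hp => ?_, ⟨K, fun p hp => ?_⟩, fun p hp => ?_⟩
    · exact hK.differentiableAt (h₁.1.1 hp.1.1) (h₂.1.1 hp.1.2)
        (h₁.2.1 _ hp.1.1 _ (Ioo_subset_Icc_self (h₂.1.1 hp.1.2)))
        (h₂.2.1 _ hp.1.2 _ (Ioo_subset_Icc_self (h₁.1.1 hp.1.1)))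
    · obtain ⟨v, -, hv₁, hv₂⟩ := key p hp
      exact ⟨hv₁.differentiableAt, hv₂.differentiableAt⟩
    · obtain ⟨v, hv, hv₁, hv₂⟩ := key p hp
      rw [partialSnd, partialFst, hv₁.deriv, hv₂.deriv]
      exact ⟨hv, hv⟩
    · obtain ⟨v, hv, hv₁, hv₂⟩ := key p hp
      rw [partialSnd, partialFst, hv₁.deriv, hv₂.deriv]
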